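/- Fix $K, L \ge 1$. For $(\bar u,\bar v)\in[0,1]^K\times[0,1]^L$, consider the following Bernoulli rank-1 bandit. At every time $t$, vectors $u_t\in\{0,1\}^K$ and $v_t\in\{0,1\}^L$ are drawn, all of whose entries are independent Bernoulli variables with means $\bar u(i)$ and $\bar v(j)$; the draws are independent over time. The agent chooses an arm $(i_t,j_t)\in[K]\times[L]$, possibly at random, based on the arms it chose and the products it observed before time $t$ (and, possibly, on the horizon $n$), and then observes $u_t(i_t)v_t(j_t)$, which is its reward. Let $(i^*,j^*)$ be an arm that maximizes $\bar u(i)\bar v(j)$, and let $$R(n)=\mathbb E\Big[\sum_{t=1}^n \big(u_t(i^*)v_t(j^*)-u_t(i_t)v_t(j_t)\big)\Big]$$ be the $n$-step regret. An algorithm is uniformly efficient if $R(n)=o(n^\alpha)$ for every problem $(\bar u,\bar v)\in[0,1]^K\times[0,1]^L$ and every $\alpha\in(0,1)$. Theorem. For every problem $(\bar u,\bar v)\in[0,1]^K\times[0,1]^L$ with a unique best arm $(i^*,j^*)$ and every uniformly efficient algorithm, the regret $R(n)$ of the algorithm on this problem satisfies $$\liminf_{n\to\infty}\frac{R(n)}{\log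 n}\;\ge\;\sum_{i\in[K]\setminus\{i^*\}}\frac{\bar u(i^*)\bar v(j^*)-\bar u(i)\bar v(j^*)}{d(\bar u(i)\bar v(j^*),\,\bar u(i^*)\bar v(j^*))}+\sum_{j\in[L]\setminus\{j^*\}}\frac{\bar u(i^*)\bar v(j^*)-\bar u(i^*)\bar v(j)}{d(\bar u(i^*)\bar v(j),\,\bar u(i^*)\bar v(j^*))},$$ where $d(p,q)\in[0,\infty]$ is the Kullback-Leibler divergence between Bernoulli variables with means $p$ and $q$, and $x/\infty=0$. -/

import Mathlib

noncomputable section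

namespace Rank1Bandit

open MeasureTheory ProbabilityTheory
open scoped ENNReal unitInterval

/-- The arms of a rank-1 bandit with `K` rows and `L` columns. -/
abbrev Arm (K L : ℕ) : Type := Fin K × Fin L

/-- The latent row vector and column vector drawn in one time step; the entries are `0` or `1`,
written `false` and `true`. -/
abbrev Draw (K L : ℕ) : Type := (Fin K → Bool) × (Fin L → Bool)

/-- Everything that happens in one time step: the chosen arm and the latent draw. -/
abbrev Step (K L : ℕ) : Type := Arm K L × Draw K L

/-- The observation `u_t(i) * v_t(j)` made when arm `(i, j)` is chosen. -/
def observe {K L : ℕ} (a : Arm K L) (w : Draw K L) : Bool := w.1 a.1 && w.2 a.2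

/-- The reward `u_t(i) * v_t(j)`, as a real number. -/
def reward {K L : ℕ} (a : Arm K L) (w : Draw K L) : ℝ :=
  (if w.1 a.1 then 1 else 0) * (if w.2 a.2 then 1 else 0)

/-- The law of a vector of independent Bernoulli variables with means `p`. -/
def prodBernoulli {m : ℕ} (p : Fin m → I) : PMF (Fin m → Bool) :=
  (Measure.pi fun i => bernoulliMeasure true false (p i)).toPMF

/-- The law of one latent draw in the problem with means `u` and `v`: the row vector and the
column vector are independent. -/
def drawLaw {K L : ℕ} (u : Fin K → I) (v : Fin L → I) : PMF (Draw K L) :=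
  (prodBernoulli u).bind fun x => (prodBernoulli v).map fun y => (x, y)

/-- A (possibly randomized) policy: after `t` steps, the distribution of the next arm as a
function of the arms chosen and the products observed so far. -/
abbrev Policy (K L : ℕ) : Type := ∀ t : ℕ, (Fin t → Arm K L × Bool) → PMF (Arm K L)

/-- An algorithm gives for every horizon `n` the policy that is run for `n` steps. Algorithms that
do not use the horizon are the constant functions. -/
abbrev Algorithm (K L : ℕ) : Type := ℕ → Policy K L

/-- The part of a run that is visible to the agent. -/
def history {K L t : ℕ} (ω : Fin t → Step K L) : Fin t → Arm K L × Bool :=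
  fun s => ((ω s).1, observe (ω s).1 (ω s).2)

/-- The law of the first `n` steps when policy `π` interacts with the problem `(u, v)`: in each
step an arm is drawn given the history, and a fresh latent vector pair is drawn independently of
the past and of the chosen arm. -/
def runLaw {K L : ℕ} (π : Policy K L) (u : Fin K → I) (v : Fin L → I) :
    ∀ n : ℕ, PMF (Fin n → Step K L)
  | 0 => PMF.pure Fin.elim0
  | n + 1 => (runLaw π u v n).bind fun ω =>
      (π n (history ω)).bind fun a =>
        (drawLaw u v).map fun w => Fin.snoc (α := fun _ => Step K L) ω (a, w)

/-- The mean reward of an arm. -/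
def mean {K L : ℕ} (u : Fin K → I) (v : Fin L → I) (a : Arm K L) : I := u a.1 * v a.2

/-- `b` maximizes the mean reward. -/
def IsBestArm {K L : ℕ} (u : Fin K → I) (v : Fin L → I) (b : Arm K L) : Prop :=
  ∀ a : Arm K L, mean u v a ≤ mean u v b

/-- `b` is the only arm that maximizes the mean reward. -/
def IsUniqueBestArm {K L : ℕ} (u : Fin K → I) (v : Fin L → I) (b : Arm K L) : Prop :=
  IsBestArm u v b ∧ ∀ a : Arm K L, IsBestArm u v a → a = b

/-- The expected cumulative regret in `n` steps of policy `π`, relative to the arm `b`. -/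
def policyRegret {K L : ℕ} (π : Policy K L) (u : Fin K → I) (v : Fin L → I) (b : Arm K L)
    (n : ℕ) : ℝ :=
  ∑ ω : Fin n → Step K L, (runLaw π u v n ω).toReal *
    ∑ t : Fin n, (reward b (ω t).2 - reward (ω t).1 (ω t).2)

/-- The `n`-step regret of an algorithm. -/
def regret {K L : ℕ} (A : Algorithm K L) (u : Fin K → I) (v : Fin L → I) (b : Arm K L)
    (n : ℕ) : ℝ :=
  policyRegret (A n) u v b n

/-- In every Bernoulli rank-1 bandit with `K` rows and `L` columns, the regret is `o(n ^ α)` for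
all `α ∈ (0, 1)`. If there are several best arms, the regret does not depend on which of them is
used as the reference. -/
def UniformlyEfficient {K L : ℕ} (A : Algorithm K L) : Prop :=
  ∀ (u : Fin K → I) (v : Fin L → I) (b : Arm K L), IsBestArm u v b →
    ∀ α : ℝ, 0 < α → α < 1 →
      Asymptotics.IsLittleO Filter.atTop (fun n : ℕ => regret A u v b n)
        (fun n : ℕ => (n : ℝ) ^ α)

/-- The Kullback-Leibler divergence between Bernoulli variables with means `p` and `q`. -/
def d (p q : I) : ℝ≥0∞ :=
  InformationTheory.klDiv (bernoulliMeasure true false p) (bernoulliMeasure true false q)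

end Rank1Bandit

end

noncomputable section

namespace Rank1Bandit

open MeasureTheory ProbabilityTheory
open scoped ENNReal unitInterval

/-! This is a change-of-measure argument in the style of Lai and Robbins. The agent sees only
Bernoulli products, so a problem matters only through its matrix of means.

Fix a row `i ≠ i₀`. Multiplying `u` by `v j₀` and dividing `v` by `v j₀` changes no mean, but makes
the entry of column `j₀` equal to one. The entry of row `i` can then be set to any `q < 1` just
above the best mean: only the means in row `i` change, and `(i, j₀)` becomes optimal
(`exists_isAlternative_row`). An algorithm with small regret in both problems must tell them apart,
which costs about `log n` of information (`UniformlyEfficient.eventually_log_le`). An arm `(i, j)`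
supplies at most the fraction `v j / v j₀` of the information of `(i, j₀)` (`klReal_mul_mul_le`), so
the pulls of row `i`, weighted by this fraction, total at least about `log n` divided by the
divergence. Columns are symmetric.

A pull of `(i, j)` counts for row `i` and for column `j`. Its gap pays for both, because the gap
minus the two charges is `(u i₀ - u i) * (v j₀ - v j) ≥ 0` (`sum_gap_mul_weight_le`). Hence the row
and column bounds add up. -/

/-! ### Expectations under laws on finite types -/

/-- The expectation of a real function under a law on a finite type. -/
def ex {α : Type*} [Fintype α] (P : PMF α) (f : α → ℝ) : ℝ := ∑ a, (P a).toReal * f a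

section Expectation

variable {α β : Type*} [Fintype α] [Fintype β]

lemma ex_mono (P : PMF α) {f g : α → ℝ} (h : ∀ a, f a ≤ g a) : ex P f ≤ ex P g :=
  Finset.sum_le_sum fun a _ => mul_le_mul_of_nonneg_left (h a) ENNReal.toReal_nonneg

lemma ex_nonneg (P : PMF α) {f : α → ℝ} (h : ∀ a, 0 ≤ f a) : 0 ≤ ex P f :=
  Finset.sum_nonneg fun a _ => mul_nonneg ENNReal.toReal_nonneg (h a)

lemma ex_add (P : PMF α) (f g : α → ℝ) : ex P (fun a => f a + g a) = ex P f + ex P g := by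
  simp [ex, mul_add, Finset.sum_add_distrib]

lemma ex_sub (P : PMF α) (f g : α → ℝ) : ex P (fun a => f a - g a) = ex P f - ex P g := by
  simp [ex, mul_sub, Finset.sum_sub_distrib]

lemma ex_const_mul (P : PMF α) (c : ℝ) (f : α → ℝ) : ex P (fun a => c * f a) = c * ex P f := by
  simp only [ex, Finset.mul_sum]
  exact Finset.sum_congr rfl fun a _ => by ring

lemma ex_sum {ι : Type*} (s : Finset ι) (P : PMF α) (f : ι → α → ℝ) :
    ex P (fun a => ∑ i ∈ s, f i a) = ∑ i ∈ s, ex P (f i) := by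
  simp only [ex, Finset.mul_sum]
  exact Finset.sum_comm

lemma sum_toReal (P : PMF α) : ∑ a, (P a).toReal = 1 := by
  rw [← ENNReal.toReal_sum fun a _ => P.apply_ne_top a, ← tsum_fintype (L := .unconditional _),
    P.tsum_coe, ENNReal.toReal_one]

lemma ex_const (P : PMF α) (c : ℝ) : ex P (fun _ => c) = c := by
  rw [ex, ← Finset.sum_mul, sum_toReal, one_mul]

lemma ex_bind (P : PMF α) (Q : α → PMF β) (f : β → ℝ) :
    ex (P.bind Q) f = ex P fun a => ex (Q a) f := by
  have h : ∀ b, ((P.bind Q) b).toReal = ∑ a, (P a).toReal * (Q a b).toReal := fun b => by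
    rw [PMF.bind_apply, tsum_fintype, ENNReal.toReal_sum fun a _ =>
      ENNReal.mul_ne_top (P.apply_ne_top a) ((Q a).apply_ne_top b)]
    simp
  simp only [ex, h, Finset.sum_mul, Finset.mul_sum, mul_assoc]
  exact Finset.sum_comm

lemma ex_pure (a : α) (f : α → ℝ) : ex (PMF.pure a) f = f a := by
  classical
  rw [ex, Finset.sum_eq_single a] <;> simp +contextual

lemma ex_map (P : PMF α) (g : α → β) (f : β → ℝ) : ex (P.map g) f = ex P fun a => f (g a) := by
  simp only [PMF.map, ex_bind, Function.comp_apply, ex_pure]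

end Expectation

/-! ### Bernoulli laws -/

/-- The Bernoulli law with mean `p`. -/
def ber (p : I) : PMF Bool := (bernoulliMeasure true false p).toPMF

lemma ber_true (p : I) : (ber p true).toReal = p := by
  simp [ber, Measure.toPMF_apply]

lemma ber_false (p : I) : (ber p false).toReal = 1 - p := by
  simp [ber, Measure.toPMF_apply]

lemma ex_ber (p : I) (f : Bool → ℝ) : ex (ber p) f = p * f true + (1 - p) * f false := by
  simp [ex, ber_true, ber_false]

lemma ex_prodBernoulli {m : ℕ} (p : Fin m → I) (i : Fin m) (f : Bool → ℝ) :
    ex (prodBernoulli p) (fun x => f (x i)) = ex (ber (p i)) f := by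
  rw [← ex_map (prodBernoulli p) (fun x => x i)]
  congr 1
  symm
  rw [ber, PMF.toPMF_eq_iff_toMeasure_eq,
    ← PMF.toMeasure_map _ (prodBernoulli p) (measurable_pi_apply i), prodBernoulli, Measure.toPMF_toMeasure]
  exact (measurePreserving_eval (fun i => bernoulliMeasure true false (p i)) i).map_eq.symm

/-- A product of two independent Bernoulli variables is Bernoulli with the product mean; this is why
the factors `u` and `v` may be rescaled. -/
lemma ex_drawLaw_observe {K L : ℕ} (u : Fin K → I) (v : Fin L → I) (a : Arm K L) (f : Bool → ℝ) :
    ex (drawLaw u v) (fun w => f (observe a w)) = ex (ber (mean u v a)) f := by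
  simp only [drawLaw, ex_bind, ex_map, observe]
  have h : ∀ x : Fin K → Bool, ex (prodBernoulli v) (fun y => f (x a.1 && y a.2)) =
      ex (ber (v a.2)) fun y => f (x a.1 && y) := fun x =>
    ex_prodBernoulli v a.2 fun y => f (x a.1 && y)
  simp only [h]
  rw [ex_prodBernoulli u a.1 fun x => ex (ber (v a.2)) fun y => f (x && y)]
  simp only [ex_ber, mean, Bool.true_and, Bool.false_and, Set.Icc.coe_mul]
  ring

lemma ex_drawLaw_reward {K L : ℕ} (u : Fin K → I) (v : Fin L → I) (a : Arm K L) :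
    ex (drawLaw u v) (reward a) = mean u v a := by
  have h : reward a = fun w : Draw K L => if observe a w then (1 : ℝ) else 0 := by
    funext w
    rcases h1 : w.1 a.1 <;> rcases h2 : w.2 a.2 <;> simp [reward, observe, h1, h2]
  rw [h, ex_drawLaw_observe u v a fun b => if b then (1 : ℝ) else 0, ex_ber]
  simp

/-! ### The law of the visible history -/

/-- The law of the first `n` arms and observations when policy `π` runs in a bandit in which the
observations are Bernoulli with means `μ`. -/
def histLaw {K L : ℕ} (π : Policy K L) (μ : Arm K L → I) : ∀ n : ℕ, PMF (Fin n → Arm K L × Bool)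
  | 0 => PMF.pure Fin.elim0
  | n + 1 => (histLaw π μ n).bind fun h =>
      (π n h).bind fun a =>
        (ber (μ a)).map fun x => Fin.snoc (α := fun _ => Arm K L × Bool) h (a, x)

section History

variable {K L : ℕ} (π : Policy K L)

lemma ex_histLaw_succ (μ : Arm K L → I) (n : ℕ) (f : (Fin (n + 1) → Arm K L × Bool) → ℝ) :
    ex (histLaw π μ (n + 1)) f = ex (histLaw π μ n) fun h => ex (π n h) fun a =>
      ex (ber (μ a)) fun x => f (Fin.snoc (α := fun _ => Arm K L × Bool) h (a, x)) := by
  simp only [histLaw, ex_bind, ex_map]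

lemma ex_runLaw_succ (u : Fin K → I) (v : Fin L → I) (n : ℕ) (f : (Fin (n + 1) → Step K L) → ℝ) :
    ex (runLaw π u v (n + 1)) f = ex (runLaw π u v n) fun ω => ex (π n (history ω)) fun a =>
      ex (drawLaw u v) fun w => f (Fin.snoc (α := fun _ => Step K L) ω (a, w)) := by
  simp only [runLaw, ex_bind, ex_map]

lemma history_snoc {n : ℕ} (ω : Fin n → Step K L) (a : Arm K L) (w : Draw K L) :
    history (Fin.snoc (α := fun _ => Step K L) ω (a, w)) =
      Fin.snoc (α := fun _ => Arm K L × Bool) (history ω) (a, observe a w) := by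
  funext s
  refine Fin.lastCases ?_ (fun s => ?_) s <;> simp [history]

/-- The policy reads only the history, so latent draws can be integrated out step by step. Problems
can then be compared on `histLaw`. -/
lemma ex_runLaw_history (u : Fin K → I) (v : Fin L → I) (n : ℕ)
    (f : (Fin n → Arm K L × Bool) → ℝ) :
    ex (runLaw π u v n) (fun ω => f (history ω)) = ex (histLaw π (mean u v) n) f := by
  induction n with
  | zero => simp only [runLaw, histLaw, ex_pure]; congr 1; funext s; exact s.elim0
  | succ n ih =>
    rw [ex_runLaw_succ, ex_histLaw_succ, ← ih]
    simp only [history_snoc]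
    congr 1; funext ω; congr 1; funext a
    exact ex_drawLaw_observe u v a fun x =>
      f (Fin.snoc (α := fun _ => Arm K L × Bool) (history ω) (a, x))

lemma ex_runLaw_sum (u : Fin K → I) (v : Fin L → I) (n : ℕ) (φ : Arm K L → Draw K L → ℝ) :
    ex (runLaw π u v n) (fun ω => ∑ t, φ (ω t).1 (ω t).2) =
      ex (histLaw π (mean u v) n) fun h => ∑ t, ex (drawLaw u v) (φ (h t).1) := by
  induction n with
  | zero => simp [runLaw, histLaw, ex_pure]
  | succ n ih =>
    rw [ex_runLaw_succ, ex_histLaw_succ]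
    simp only [Fin.sum_univ_castSucc, Fin.snoc_castSucc, Fin.snoc_last, ex_add, ex_const, ih]
    congr 1
    exact ex_runLaw_history π u v n fun h => ex (π n h) fun a => ex (drawLaw u v) (φ a)

/-- Given the past and the chosen arm, an observation has law `ber`. For log-likelihood ratios this
is the chain rule for the divergence. -/
lemma ex_histLaw_sum (μ : Arm K L → I) (n : ℕ) (φ : Arm K L → Bool → ℝ) :
    ex (histLaw π μ n) (fun h => ∑ t, φ (h t).1 (h t).2) =
      ex (histLaw π μ n) fun h => ∑ t, ex (ber (μ (h t).1)) (φ (h t).1) := by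
  induction n with
  | zero => simp
  | succ n ih =>
    rw [ex_histLaw_succ, ex_histLaw_succ]
    simp only [Fin.sum_univ_castSucc, Fin.snoc_castSucc, Fin.snoc_last, ex_add, ex_const, ih]

lemma policyRegret_eq (u : Fin K → I) (v : Fin L → I) (b : Arm K L) (n : ℕ) :
    policyRegret π u v b n = ex (histLaw π (mean u v) n) fun h =>
      ∑ t, ((mean u v b : ℝ) - mean u v (h t).1) := by
  have h := ex_runLaw_sum π u v n fun a w => reward b w - reward a w
  simp only [ex_sub, ex_drawLaw_reward] at h
  exact h

/-! ### Change of measure -/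

/-- The policy factors are common to both laws and cancel. Only an inequality is asked for, so
histories that are possible under `μ'` but not under `μ` do no harm. -/
lemma ex_histLaw_mul_exp_le {μ μ' : Arm K L → I} {l : Arm K L → Bool → ℝ}
    (hl : ∀ a x, (ber (μ a) x).toReal * Real.exp (-l a x) ≤ (ber (μ' a) x).toReal) (n : ℕ)
    {f : (Fin n → Arm K L × Bool) → ℝ} (hf : ∀ h, 0 ≤ f h) :
    ex (histLaw π μ n) (fun h => Real.exp (-∑ t, l (h t).1 (h t).2) * f h) ≤
      ex (histLaw π μ' n) f := by
  induction n with
  | zero => simp [histLaw, ex_pure]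
  | succ n ih =>
    rw [ex_histLaw_succ, ex_histLaw_succ]
    refine le_trans (ex_mono _ fun h => ?_) (ih fun h => ex_nonneg _ fun a =>
      ex_nonneg _ fun x => hf (Fin.snoc (α := fun _ => Arm K L × Bool) h (a, x)))
    rw [← ex_const_mul]
    refine ex_mono _ fun a => ?_
    simp only [ex, Finset.mul_sum]
    refine Finset.sum_le_sum fun x _ => ?_
    simp only [Fin.sum_univ_castSucc, Fin.snoc_castSucc, Fin.snoc_last, neg_add, Real.exp_add]
    have h1 := mul_le_mul_of_nonneg_right (hl a x)
      (mul_nonneg (Real.exp_pos (-∑ t, l (h t).1 (h t).2)).le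
        (hf (Fin.snoc (α := fun _ => Arm K L × Bool) h (a, x))))
    linarith

end History

/-- A lower bound on the sum of the two error probabilities of a test between the laws `P` and `Q`
in terms of the mean log-likelihood ratio. The test may be randomized. -/
lemma exp_le_test_errors {α : Type*} [Fintype α] {P Q : PMF α} {l : α → ℝ}
    (hPQ : ∀ f : α → ℝ, (∀ a, 0 ≤ f a) → ex P (fun a => Real.exp (-l a) * f a) ≤ ex Q f)
    {f g : α → ℝ} (hf : ∀ a, 0 ≤ f a) (hg : ∀ a, 0 ≤ g a) (hfg : ∀ a, 1 ≤ f a ∨ 1 ≤ g a) :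
    Real.exp (-(ex P l + 1)) ≤ ex P f + ex Q g := by
  have h1 : ex P (fun a => Real.exp (-l a)) ≤ 1 := by
    simpa [ex_const] using hPQ (fun _ => 1) fun _ => zero_le_one
  -- The positive part is used because `exp (-max l 0)` lies below both `1` and `exp (-l)`, the
  -- weights of `f` and `g`. It costs at most the mean of `exp (-l)`, whence the `+ 1` in the
  -- statement.
  have h2 : ex P (fun a => max (l a) 0) ≤ ex P l + 1 := by
    have h3 : ex P (fun a => max (l a) 0) ≤ ex P (fun a => l a + Real.exp (-l a)) :=
      ex_mono _ fun a => max_le (le_add_of_nonneg_right (Real.exp_pos _).le)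
        (by linarith [Real.add_one_le_exp (-l a)])
    rw [ex_add] at h3
    linarith
  set c := ex P (fun a => max (l a) 0) with hc
  have h4 : Real.exp (-c) ≤ ex P (fun a => Real.exp (-max (l a) 0)) := by
    -- Jensen's inequality, through the tangent of the exponential at the mean `c`.
    have h5 : ex P (fun a => Real.exp (-c) * (1 + c - max (l a) 0)) = Real.exp (-c) := by
      rw [ex_const_mul, ex_sub, ex_const, ← hc]; ring
    rw [← h5]
    refine ex_mono _ fun a => ?_
    have h6 : Real.exp (-max (l a) 0) = Real.exp (-c) * Real.exp (c - max (l a) 0) := by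
      rw [← Real.exp_add]; ring_nf
    rw [h6]
    exact mul_le_mul_of_nonneg_left (by linarith [Real.add_one_le_exp (c - max (l a) 0)])
      (Real.exp_pos _).le
  calc Real.exp (-(ex P l + 1)) ≤ Real.exp (-c) := Real.exp_le_exp.2 (by linarith)
    _ ≤ _ := h4
    _ ≤ ex P (fun a => f a + Real.exp (-l a) * g a) := ex_mono _ fun a => by
      rcases hfg a with h | h
      · have h7 : Real.exp (-max (l a) 0) ≤ 1 := Real.exp_le_one_iff.2 (by simp)
        have h8 := mul_nonneg (Real.exp_pos (-l a)).le (hg a)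
        linarith
      · have h7 : Real.exp (-max (l a) 0) ≤ Real.exp (-l a) :=
          Real.exp_le_exp.2 (neg_le_neg (le_max_left _ _))
        have h8 := mul_le_mul_of_nonneg_left h (Real.exp_pos (-l a)).le
        linarith [hf a]
    _ ≤ ex P f + ex Q g := by rw [ex_add]; exact add_le_add_right (hPQ g hg) _


/-! ### The Kullback-Leibler divergence of Bernoulli laws -/

/-- The Kullback-Leibler divergence between Bernoulli laws, as a real number. -/
def klReal (p q : ℝ) : ℝ := p * Real.log (p / q) + (1 - p) * Real.log ((1 - p) / (1 - q))

lemma klReal_self (p : ℝ) : klReal p p = 0 := by simp [klReal]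

lemma sub_le_mul_log_div {x y : ℝ} (hx : 0 ≤ x) (hy : 0 < y) : x - y ≤ x * Real.log (x / y) := by
  rcases hx.eq_or_lt with rfl | hx
  · simpa using hy.le
  · have h := Real.one_sub_inv_le_log_of_pos (div_pos hx hy)
    calc x - y = x * (1 - (x / y)⁻¹) := by field_simp
      _ ≤ _ := mul_le_mul_of_nonneg_left h hx.le

lemma klReal_nonneg {p q : ℝ} (hp : p ∈ Set.Icc (0 : ℝ) 1) (hq : q ∈ Set.Ioo (0 : ℝ) 1) :
    0 ≤ klReal p q := by
  have h1 := sub_le_mul_log_div hp.1 hq.1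
  have h2 := sub_le_mul_log_div (sub_nonneg.2 hp.2) (sub_pos.2 hq.2)
  rw [klReal]
  linarith

/-- Scaling both means by `b` shrinks the divergence by at least the factor `b`. -/
lemma klReal_mul_mul_le {b p q : ℝ} (hb : b ∈ Set.Icc (0 : ℝ) 1) (hp : p ∈ Set.Icc (0 : ℝ) 1)
    (hq : q ∈ Set.Ioo (0 : ℝ) 1) : klReal (b * p) (b * q) ≤ b * klReal p q := by
  rcases hb.1.eq_or_lt with rfl | hb0
  · simp [klReal]
  have h1 : b * p / (b * q) = p / q := mul_div_mul_left _ _ hb0.ne'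
  have hbp : b * p ≤ 1 := mul_le_one₀ hb.2 hp.1 hp.2
  have hbq : b * q < 1 := by nlinarith [hb.2, hq.1, hq.2]
  rcases hbp.eq_or_lt with hbp | hbp
  · have : b = 1 := by nlinarith [hb.2, hp.1, hp.2]
    simp [this]
  have hy : 0 < 1 - b * q := by linarith
  have hx : 0 < 1 - b * p := by linarith
  have h2 : (1 - b * p) * Real.log ((1 - b * p) / (1 - b * q)) ≤
      b * ((1 - p) * Real.log ((1 - p) / (1 - q))) := by
    have hr : 0 < (1 - b * p) / (1 - b * q) := div_pos hx hy
    rcases hp.2.eq_or_lt with rfl | hp1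
    · have := Real.log_nonpos hr.le ((div_le_one hy).2 (by nlinarith [hq.2]))
      simp only [mul_one, sub_self, zero_mul, mul_zero] at *
      exact mul_nonpos_of_nonneg_of_nonpos hx.le this
    · have hs : 0 < (1 - p) / (1 - q) := div_pos (by linarith) (by linarith [hq.2])
      -- Log-sum inequality for `1 - b * p = b * (1 - p) + (1 - b)` and likewise for `q`. With
      -- weights `b * (1 - p)` and `1 - b`, the two linear bounds cancel exactly in `h7`.
      have h3 := Real.log_le_sub_one_of_pos (div_pos hr hs)
      have h4 := Real.log_le_sub_one_of_pos hr
      rw [Real.log_div hr.ne' hs.ne'] at h3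
      have h5 : b * (1 - p) * (Real.log ((1 - b * p) / (1 - b * q)) -
          Real.log ((1 - p) / (1 - q))) ≤
          b * (1 - p) * ((1 - b * p) / (1 - b * q) / ((1 - p) / (1 - q)) - 1) :=
        mul_le_mul_of_nonneg_left h3 (mul_nonneg hb.1 (by linarith))
      have h6 : (1 - b) * Real.log ((1 - b * p) / (1 - b * q)) ≤
          (1 - b) * ((1 - b * p) / (1 - b * q) - 1) :=
        mul_le_mul_of_nonneg_left h4 (by linarith [hb.2])
      have h7 : b * (1 - p) * ((1 - b * p) / (1 - b * q) / ((1 - p) / (1 - q)) - 1) +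
          (1 - b) * ((1 - b * p) / (1 - b * q) - 1) = 0 := by
        have : 1 - p ≠ 0 := by linarith
        have : 1 - q ≠ 0 := by linarith [hq.2]
        field_simp
        ring
      linarith
  rw [klReal, klReal, h1]
  linarith

lemma tendsto_klReal (p : ℝ) {q : ℝ} (hq : q ∈ Set.Ioo (0 : ℝ) 1) :
    Filter.Tendsto (klReal p) (nhds q) (nhds (klReal p q)) := by
  have h1 : q ≠ 0 := hq.1.ne'
  have h2 : 1 - q ≠ 0 := (sub_pos.2 hq.2).ne'
  -- If `p` is `0` or `1`, one coefficient vanishes and its term is constant, so continuity of the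
  -- logarithm is not needed there.
  have h : ∀ x y : ℝ, y ≠ 0 → ContinuousAt (fun z => x * Real.log (x / z)) y := fun x y hy => by
    rcases eq_or_ne x 0 with rfl | hx
    · simpa using continuousAt_const
    · exact continuousAt_const.mul
        ((continuousAt_const.div continuousAt_id hy).log (div_ne_zero hx hy))
  exact (h p q h1).add (ContinuousAt.comp (f := fun z => 1 - z) (h (1 - p) (1 - q) h2)
    (continuousAt_const.sub continuousAt_id))

lemma bernoulliMeasure_eq_withDensity (p : I) {q : I} (hq0 : 0 < (q : ℝ)) (hq1 : (q : ℝ) < 1) :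
    bernoulliMeasure true false p = (bernoulliMeasure true false q).withDensity fun x =>
      ENNReal.ofReal (if x then p / q else (1 - p) / (1 - q)) := by
  refine Measure.ext_of_singleton fun x => ?_
  rw [withDensity_apply _ (measurableSet_singleton x), lintegral_singleton]
  have h1 : (1 : ℝ) - q ≠ 0 := by linarith
  have hp := p.2.2
  have hp' := p.2.1
  refine (ENNReal.toReal_eq_toReal_iff' (measure_ne_top _ _)
    (ENNReal.mul_ne_top ENNReal.ofReal_ne_top (measure_ne_top _ _))).1 ?_
  rw [ENNReal.toReal_mul, ← measureReal_def, ← measureReal_def]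
  cases x
  · rw [bernoulliMeasure_real_apply_of_notMem_of_mem _ (by simp) (by simp) (by simp),
      bernoulliMeasure_real_apply_of_notMem_of_mem _ (by simp) (by simp) (by simp),
      ENNReal.toReal_ofReal]
    · simp [h1]
    · simp only [Bool.false_eq_true, if_false]
      exact div_nonneg (by linarith) (by linarith)
  · rw [bernoulliMeasure_real_apply_of_mem_of_notMem _ (by simp) (by simp) (by simp),
      bernoulliMeasure_real_apply_of_mem_of_notMem _ (by simp) (by simp) (by simp),
      ENNReal.toReal_ofReal]
    · simp [hq0.ne']
    · simp only [if_true]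
      exact div_nonneg hp' hq0.le

lemma d_eq_ofReal (p : I) {q : I} (hq0 : 0 < (q : ℝ)) (hq1 : (q : ℝ) < 1) :
    d p q = ENNReal.ofReal (klReal p q) := by
  have hp := p.2
  set f : Bool → ℝ := fun x => if x then (p : ℝ) / q else (1 - p) / (1 - q) with hf
  have hf0 : ∀ x, 0 ≤ f x := fun x => by
    cases x
    · exact div_nonneg (by linarith [hp.2]) (by linarith)
    · exact div_nonneg hp.1 hq0.le
  have hd := bernoulliMeasure_eq_withDensity p hq0 hq1
  have hac : bernoulliMeasure true false p ≪ bernoulliMeasure true false q := by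
    rw [hd]; exact withDensity_absolutelyContinuous _ _
  have hae : (bernoulliMeasure true false p).rnDeriv (bernoulliMeasure true false q)
      =ᵐ[bernoulliMeasure true false q] fun x => ENNReal.ofReal (f x) := by
    conv_lhs => rw [hd]
    exact Measure.rnDeriv_withDensity _ (measurable_of_countable _)
  have hllr : llr (bernoulliMeasure true false p) (bernoulliMeasure true false q)
      =ᵐ[bernoulliMeasure true false p] fun x => Real.log (f x) := by
    filter_upwards [hac.ae_le hae] with x hx
    rw [llr, hx, ENNReal.toReal_ofReal (hf0 x)]
  rw [d, InformationTheory.klDiv_of_ac_of_integrable hac Integrable.of_finite,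
    integral_congr_ae hllr, integral_bernoulliMeasure]
  simp [klReal, hf]

lemma d_one_right {p q : I} (hp : (p : ℝ) < 1) (hq : (q : ℝ) = 1) : d p q = ⊤ := by
  refine InformationTheory.klDiv_of_not_ac fun h => ?_
  have hq1 : q = 1 := Subtype.ext hq
  have h0 : bernoulliMeasure true false q {false} = 0 := by simp [hq1]
  have h1 := congrArg ENNReal.toReal (h h0)
  rw [← measureReal_def,
    bernoulliMeasure_real_apply_of_notMem_of_mem _ (by simp) (by simp) (by simp)] at h1
  simp at h1
  linarith

/-! ### The information carried by observations -/

/-- The log-likelihood ratio of one observation. -/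
def logRatio (p q : I) (x : Bool) : ℝ := Real.log ((ber p x).toReal / (ber q x).toReal)

lemma ex_ber_logRatio (p q : I) : ex (ber p) (logRatio p q) = klReal p q := by
  simp [ex_ber, logRatio, klReal, ber_true, ber_false]

/-- Equality holds where `p` gives `x` positive mass; elsewhere the left side is zero, whatever the
default value of the logarithm. The case `p = q` admits the means `0` and `1`. -/
lemma ber_mul_exp_neg_logRatio_le {p q : I} (h : p = q ∨ 0 < (q : ℝ) ∧ (q : ℝ) < 1) (x : Bool) :
    (ber p x).toReal * Real.exp (-logRatio p q x) ≤ (ber q x).toReal := by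
  rcases h with rfl | ⟨h0, h1⟩
  · rcases eq_or_ne (ber p x).toReal 0 with h | h <;> simp [logRatio, h]
  · have hq : 0 < (ber q x).toReal := by
      cases x
      · rw [ber_false]; linarith
      · rwa [ber_true]
    rcases (ENNReal.toReal_nonneg (a := ber p x)).eq_or_lt with h | h
    · rw [← h, zero_mul]; exact hq.le
    · rw [logRatio, ← Real.log_inv, Real.exp_log (inv_pos.2 (div_pos h hq)), inv_div,
        mul_div_cancel₀ _ h.ne']


/-! ### Lower bounds on the collected information -/

section LowerBound

variable {K L : ℕ} {A : Algorithm K L}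

lemma UniformlyEfficient.eventually_regret_le (hA : UniformlyEfficient A) {u : Fin K → I}
    {v : Fin L → I} {b : Arm K L} (hb : IsBestArm u v b) {α : ℝ} (h0 : 0 < α) (h1 : α < 1) :
    ∀ᶠ n : ℕ in Filter.atTop, regret A u v b n ≤ (n : ℝ) ^ α := by
  filter_upwards [(hA u v b hb α h0 h1).bound one_pos] with n hn
  rw [one_mul, Real.norm_of_nonneg (Real.rpow_nonneg n.cast_nonneg α)] at hn
  exact (le_abs_self _).trans hn

/-- If the arms in `G` are bad in one problem and the other arms are bad in a second problem, then
an algorithm that is efficient in both has to collect the information that tells the two problems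
apart. -/
lemma UniformlyEfficient.eventually_log_le (hA : UniformlyEfficient A) {u u' : Fin K → I}
    {v v' : Fin L → I} {b b' : Arm K L} (hb : IsBestArm u v b) (hb' : IsBestArm u' v' b')
    {G : Set (Arm K L)} {δ : ℝ} (hδ : 0 < δ)
    (hG : ∀ a ∈ G, δ ≤ (mean u v b : ℝ) - mean u v a)
    (hG' : ∀ a ∉ G, δ ≤ (mean u' v' b' : ℝ) - mean u' v' a)
    (hac : ∀ a, mean u v a = mean u' v' a ∨
      0 < (mean u' v' a : ℝ) ∧ (mean u' v' a : ℝ) < 1)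
    {c : ℝ} (hc0 : 0 < c) (hc1 : c < 1) :
    ∀ᶠ n : ℕ in Filter.atTop, c * Real.log n ≤ ex (histLaw (A n) (mean u v) n) fun h =>
      ∑ t, klReal (mean u v (h t).1) (mean u' v' (h t).1) := by
  -- The test bound with regrets at most `n ^ ((1 - c) / 2)` yields information `(1 + c) / 2 * log n
  -- - 1 - log (4 / δ)`; beyond this threshold it exceeds `c * log n`.
  have hlog := (Real.tendsto_log_atTop.comp tendsto_natCast_atTop_atTop).eventually_ge_atTop
    ((1 + Real.log (4 / δ)) / ((1 - c) / 2))
  filter_upwards [hA.eventually_regret_le hb (α := (1 - c) / 2) (by linarith) (by linarith),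
    hA.eventually_regret_le hb' (α := (1 - c) / 2) (by linarith) (by linarith),
    hlog, Filter.eventually_ge_atTop 1] with n hR hR' hn hn1
  have hn0 : (0 : ℝ) < n := by exact_mod_cast hn1
  have hgap : ∀ a, 0 ≤ (mean u v b : ℝ) - mean u v a := fun a => sub_nonneg.2 (hb a)
  have hgap' : ∀ a, 0 ≤ (mean u' v' b' : ℝ) - mean u' v' a := fun a => sub_nonneg.2 (hb' a)
  have hs : 0 < 2 / (n * δ) := by positivity
  -- The tests are the rescaled regrets themselves. Every step loses at least `δ` in one of the two
  -- problems, so one of the total losses is at least `n * δ / 2`.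
  have key := exp_le_test_errors
    (P := histLaw (A n) (mean u v) n) (Q := histLaw (A n) (mean u' v') n)
    (l := fun h => ∑ t, logRatio (mean u v (h t).1) (mean u' v' (h t).1) (h t).2)
    (f := fun h => 2 / (n * δ) * ∑ t, ((mean u v b : ℝ) - mean u v (h t).1))
    (g := fun h => 2 / (n * δ) * ∑ t, ((mean u' v' b' : ℝ) - mean u' v' (h t).1))
    (fun f hf => ex_histLaw_mul_exp_le (A n) (l := fun a => logRatio (mean u v a) (mean u' v' a))
      (fun a x => ber_mul_exp_neg_logRatio_le (hac a) x) n hf)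
    (fun h => mul_nonneg hs.le (Finset.sum_nonneg fun t _ => hgap _))
    (fun h => mul_nonneg hs.le (Finset.sum_nonneg fun t _ => hgap' _))
    (fun h => by
      by_contra! hcon
      have h1 : ∑ t : Fin n, δ ≤ ∑ t, ((mean u v b : ℝ) - mean u v (h t).1) +
          ∑ t, ((mean u' v' b' : ℝ) - mean u' v' (h t).1) := by
        rw [← Finset.sum_add_distrib]
        refine Finset.sum_le_sum fun t _ => ?_
        by_cases ht : (h t).1 ∈ G
        · linarith [hG _ ht, hgap' (h t).1]
        · linarith [hG' _ ht, hgap (h t).1]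
      rw [Finset.sum_const, Finset.card_univ, Fintype.card_fin, nsmul_eq_mul] at h1
      have h2 := mul_le_mul_of_nonneg_left h1 hs.le
      rw [div_mul_cancel₀ _ (by positivity)] at h2
      linarith [hcon.1, hcon.2])
  rw [ex_const_mul, ex_const_mul, ← policyRegret_eq, ← policyRegret_eq,
    ex_histLaw_sum (A n) (mean u v) n fun a => logRatio (mean u v a) (mean u' v' a)] at key
  simp only [ex_ber_logRatio] at key
  change policyRegret (A n) u v b n ≤ _ at hR
  change policyRegret (A n) u' v' b' n ≤ _ at hR'
  have hpow : 0 < (n : ℝ) ^ ((1 - c) / 2) := Real.rpow_pos_of_pos hn0 _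
  have h3 : 2 / (n * δ) * policyRegret (A n) u v b n +
      2 / (n * δ) * policyRegret (A n) u' v' b' n ≤ 4 / δ * ((n : ℝ) ^ ((1 - c) / 2) / n) := by
    have h4 : 4 / δ * ((n : ℝ) ^ ((1 - c) / 2) / n) =
        2 / (n * δ) * ((n : ℝ) ^ ((1 - c) / 2) + (n : ℝ) ^ ((1 - c) / 2)) := by
      field_simp; ring
    rw [h4, ← mul_add]
    exact mul_le_mul_of_nonneg_left (add_le_add hR hR') hs.le
  have h5 := Real.log_le_log (Real.exp_pos _) (key.trans h3)
  rw [Real.log_exp, Real.log_mul (by positivity) (by positivity),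
    Real.log_div hpow.ne' hn0.ne', Real.log_rpow hn0] at h5
  rw [div_le_iff₀ (by linarith)] at hn
  simp only [Function.comp_apply] at hn
  linarith

lemma IsUniqueBestArm.exists_gap {u : Fin K → I} {v : Fin L → I} {b : Arm K L}
    (hb : IsUniqueBestArm u v b) :
    ∃ δ : ℝ, 0 < δ ∧ ∀ a ≠ b, δ ≤ (mean u v b : ℝ) - mean u v a := by
  have hpos : ∀ a ≠ b, 0 < (mean u v b : ℝ) - mean u v a := fun a ha => by
    refine sub_pos.2 (lt_of_le_of_ne (hb.1 a) fun h => ha (hb.2 a fun a' => ?_))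
    rw [show mean u v a = mean u v b from Subtype.ext h]
    exact hb.1 a'
  rcases (Finset.univ.erase b).eq_empty_or_nonempty with he | hne
  · refine ⟨1, one_pos, fun a ha => ?_⟩
    have := Finset.mem_erase.2 ⟨ha, Finset.mem_univ a⟩
    simp [he] at this
  · obtain ⟨a₀, ha₀, hmin⟩ := Finset.exists_min_image _
      (fun a => (mean u v b : ℝ) - mean u v a) hne
    exact ⟨_, hpos a₀ (Finset.ne_of_mem_erase ha₀), fun a ha =>
      hmin a (Finset.mem_erase.2 ⟨ha, Finset.mem_univ a⟩)⟩

/-- `(u', v')` is a problem in which the arms in `G` contain the best arm `b`, with mean `q`, and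
in which the information from an arm `a` is at most `w a` times that between means `p` and `q`. -/
structure IsAlternative (u : Fin K → I) (v : Fin L → I) (G : Set (Arm K L)) (w : Arm K L → ℝ)
    (p q : ℝ) (u' : Fin K → I) (v' : Fin L → I) (b : Arm K L) : Prop where
  best : IsBestArm u' v' b
  gap : ∃ δ : ℝ, 0 < δ ∧ ∀ a ∉ G, δ ≤ (mean u' v' b : ℝ) - mean u' v' a
  ac : ∀ a, mean u v a = mean u' v' a ∨ 0 < (mean u' v' a : ℝ) ∧ (mean u' v' a : ℝ) < 1
  info : ∀ a, klReal (mean u v a) (mean u' v' a) ≤ klReal p q * w a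

/-- The alternative needs `q > m`, while the bound involves `m`. The strict inequality in `hθ` and
continuity of the divergence leave room for such a `q`. -/
lemma UniformlyEfficient.eventually_le_of_isAlternative (hA : UniformlyEfficient A)
    {u : Fin K → I} {v : Fin L → I} {b : Arm K L} (hb : IsUniqueBestArm u v b)
    {G : Set (Arm K L)} (hbG : b ∉ G) {w : Arm K L → ℝ} (hw : ∀ a, 0 ≤ w a) {p m : ℝ}
    (hp : p ∈ Set.Icc (0 : ℝ) 1) (hm : m ∈ Set.Ioo (0 : ℝ) 1)
    (halt : ∀ q, m < q → q < 1 → ∃ u' v' b', IsAlternative u v G w p q u' v' b')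
    {θ : ℝ} (hθ0 : 0 ≤ θ) (hθ : θ * klReal p m < 1) :
    ∀ᶠ n : ℕ in Filter.atTop, θ * Real.log n ≤
      ex (histLaw (A n) (mean u v) n) fun h => ∑ t, w (h t).1 := by
  have hev : ∀ᶠ q in nhdsWithin m (Set.Ioi m), θ * klReal p q < 1 :=
    ((tendsto_klReal p hm).const_mul θ |>.eventually_lt_const hθ).filter_mono nhdsWithin_le_nhds
  have hev1 : ∀ᶠ q in nhdsWithin m (Set.Ioi m), q < 1 :=
    (eventually_lt_nhds hm.2).filter_mono nhdsWithin_le_nhds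
  obtain ⟨q, ⟨hq, hq1⟩, hmq⟩ := ((hev.and hev1).and self_mem_nhdsWithin).exists
  obtain ⟨u', v', b', hal⟩ := halt q hmq hq1
  have hk : 0 ≤ klReal p q := klReal_nonneg hp ⟨hm.1.trans hmq, hq1⟩
  obtain ⟨δ₁, hδ₁, h1⟩ := hb.exists_gap
  obtain ⟨δ₂, hδ₂, h2⟩ := hal.gap
  have hθk : 0 ≤ θ * klReal p q := mul_nonneg hθ0 hk
  -- The constant `c` is the midpoint between `θ * klReal p q` and `1`.
  filter_upwards [hA.eventually_log_le hb.1 hal.best (lt_min hδ₁ hδ₂)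
    (fun a ha => (min_le_left _ _).trans (h1 a fun h => hbG (h ▸ ha)))
    (fun a ha => (min_le_right _ _).trans (h2 a ha)) hal.ac
    (c := (1 + θ * klReal p q) / 2) (by linarith) (by linarith)] with n hn
  have hlog : 0 ≤ Real.log n := Real.log_natCast_nonneg n
  have hS : 0 ≤ ex (histLaw (A n) (mean u v) n) fun h => ∑ t, w (h t).1 :=
    ex_nonneg _ fun h => Finset.sum_nonneg fun t _ => hw _
  have h3 : (1 + θ * klReal p q) / 2 * Real.log n ≤
      klReal p q * ex (histLaw (A n) (mean u v) n) fun h => ∑ t, w (h t).1 := by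
    refine hn.trans ?_
    rw [← ex_const_mul]
    refine ex_mono _ fun h => ?_
    rw [Finset.mul_sum]
    exact Finset.sum_le_sum fun t _ => hal.info _
  rcases hk.eq_or_lt with hk | hk
  · rw [← hk] at h3
    have : Real.log n = 0 := by linarith
    rw [this, mul_zero]
    exact hS
  · refine le_of_mul_le_mul_left (le_trans ?_ h3) hk
    have := mul_le_mul_of_nonneg_right
      (show θ * klReal p q ≤ (1 + θ * klReal p q) / 2 by linarith) hlog
    linarith

/-! ### Raising one row or one column -/

/-- After a rescaling that makes `v j₀` equal to one, the entry `u i` can be raised until the arm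
`(i, j₀)` has mean `q`. -/
lemma exists_isAlternative_row {u : Fin K → I} {v : Fin L → I} {i₀ : Fin K} {j₀ : Fin L}
    (hb : IsBestArm u v (i₀, j₀)) (h0 : 0 < (u i₀ : ℝ) * v j₀) (i : Fin K) {q : ℝ}
    (hq : (u i₀ : ℝ) * v j₀ < q) (hq1 : q < 1) :
    ∃ u' v' b, IsAlternative u v {a | a.1 = i} (fun a => if a.1 = i then (v a.2 : ℝ) / v j₀ else 0)
      ((u i : ℝ) * v j₀) q u' v' b := by
  have hv0 : 0 < (v j₀ : ℝ) := pos_of_mul_pos_right h0 (u i₀).2.1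
  have hu0 : 0 < (u i₀ : ℝ) := pos_of_mul_pos_left h0 hv0.le
  have hq0 : 0 < q := h0.trans hq
  have hv : ∀ j, (v j : ℝ) ≤ v j₀ := fun j => le_of_mul_le_mul_left (hb (i₀, j)) hu0
  have hratio : ∀ j, (v j : ℝ) / v j₀ ∈ Set.Icc (0 : ℝ) 1 := fun j =>
    ⟨div_nonneg (v j).2.1 hv0.le, (div_le_one hv0).2 (hv j)⟩
  set u' : Fin K → I := Function.update (fun k => u k * v j₀) i ⟨q, hq0.le, hq1.le⟩ with hu'
  -- These entries are at most one because optimality of `(i₀, j₀)` makes `v j₀` a largest entry of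
  -- `v`.
  set v' : Fin L → I := fun j => ⟨(v j : ℝ) / v j₀, hratio j⟩ with hv'
  have hrow : ∀ j, (mean u' v' (i, j) : ℝ) = v j / v j₀ * q := fun j => by
    simp [mean, hu', hv', mul_comm]
  have hne : ∀ a : Arm K L, a.1 ≠ i → mean u' v' a = mean u v a := fun a ha => by
    refine Subtype.ext ?_
    simp only [mean, hu', hv', Function.update_of_ne ha, Set.Icc.coe_mul]
    field_simp
  have hbest : (mean u' v' (i, j₀) : ℝ) = q := by rw [hrow, div_self hv0.ne', one_mul]
  have hother : ∀ a : Arm K L, a.1 ≠ i → (mean u' v' a : ℝ) ≤ u i₀ * v j₀ := fun a ha => by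
    rw [hne a ha]; exact hb a
  refine ⟨u', v', (i, j₀), ⟨?_, ⟨q - u i₀ * v j₀, sub_pos.2 hq, ?_⟩, ?_, ?_⟩⟩
  · rintro ⟨k, j⟩
    rw [← Subtype.coe_le_coe, hbest]
    by_cases hk : k = i
    · rw [hk, hrow]
      exact mul_le_of_le_one_left hq0.le (hratio j).2
    · exact (hother _ hk).trans hq.le
  · intro a ha
    rw [hbest]
    linarith [hother a ha]
  · rintro ⟨k, j⟩
    by_cases hk : k = i
    · subst hk
      -- If `v j = 0`, the arm has mean zero in both problems and reveals nothing.
      rcases (v j).2.1.eq_or_lt with h | h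
      · refine Or.inl (Subtype.ext ?_)
        rw [hrow]
        simp [mean, ← h]
      · refine Or.inr ?_
        rw [hrow]
        exact ⟨mul_pos (div_pos h hv0) hq0,
          (mul_le_of_le_one_left hq0.le (hratio j).2).trans_lt hq1⟩
    · exact Or.inl (hne _ hk).symm
  · rintro ⟨k, j⟩
    by_cases hk : k = i
    · subst hk
      rw [hrow, if_pos rfl, mul_comm (klReal _ _)]
      have h1 : (mean u v (k, j) : ℝ) = v j / v j₀ * (u k * v j₀) := by
        simp only [mean, Set.Icc.coe_mul]
        field_simp
      rw [h1]
      exact klReal_mul_mul_le (hratio j) (u k * v j₀).2 ⟨hq0, hq1⟩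
    · rw [hne _ hk, klReal_self, if_neg hk, mul_zero]

lemma mean_swap (u : Fin K → I) (v : Fin L → I) (a : Arm K L) : mean v u a.swap = mean u v a :=
  mul_comm _ _

/-- Transposing the bandit turns columns into rows. -/
lemma exists_isAlternative_col {u : Fin K → I} {v : Fin L → I} {i₀ : Fin K} {j₀ : Fin L}
    (hb : IsBestArm u v (i₀, j₀)) (h0 : 0 < (u i₀ : ℝ) * v j₀) (j : Fin L) {q : ℝ}
    (hq : (u i₀ : ℝ) * v j₀ < q) (hq1 : q < 1) :
    ∃ u' v' b, IsAlternative u v {a | a.2 = j} (fun a => if a.2 = j then (u a.1 : ℝ) / u i₀ else 0)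
      ((u i₀ : ℝ) * v j) q u' v' b := by
  rw [mul_comm] at h0 hq ⊢
  obtain ⟨v', u', b, hbest, ⟨δ, hδ, hgap⟩, hac, hinfo⟩ := exists_isAlternative_row
    (fun a => by
      have h := hb a.swap
      rwa [← mean_swap v u a, ← mean_swap v u (j₀, i₀)]) h0 j hq hq1
  refine ⟨u', v', b.swap, ⟨fun a => ?_, ⟨δ, hδ, fun a ha => ?_⟩, fun a => ?_, fun a => ?_⟩⟩
  · rw [mean_swap, ← mean_swap u' v' a]; exact hbest a.swap
  · rw [mean_swap, ← mean_swap u' v' a]; exact hgap a.swap ha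
  · rw [← mean_swap u' v' a, ← mean_swap u v a]; exact hac a.swap
  · rw [← mean_swap u' v' a, ← mean_swap u v a]; exact hinfo a.swap

end LowerBound


/-! ### The regret -/

section Regret

variable {K L : ℕ}

lemma regret_nonneg (A : Algorithm K L) {u : Fin K → I} {v : Fin L → I} {b : Arm K L}
    (hb : IsBestArm u v b) (n : ℕ) : 0 ≤ regret A u v b n := by
  rw [regret, policyRegret_eq]
  exact ex_nonneg _ fun h => Finset.sum_nonneg fun t _ => sub_nonneg.2 (hb _)

lemma zero_le_liminf_regret (A : Algorithm K L) {u : Fin K → I} {v : Fin L → I} {b : Arm K L}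
    (hb : IsBestArm u v b) :
    0 ≤ Filter.liminf (fun n : ℕ => ((regret A u v b n / Real.log (n : ℝ) : ℝ) : EReal))
      Filter.atTop :=
  Filter.le_liminf_of_le (by isBoundedDefault) <| Filter.Eventually.of_forall fun n =>
    EReal.coe_nonneg.2 (div_nonneg (regret_nonneg A hb n) (Real.log_natCast_nonneg n))

/-- The gap of an arm pays for the information it provides on its row and on its column. -/
lemma sum_gap_mul_weight_le {u : Fin K → I} {v : Fin L → I} {i₀ : Fin K} {j₀ : Fin L}
    (hb : IsBestArm u v (i₀, j₀)) (h0 : 0 < (u i₀ : ℝ) * v j₀) (a : Arm K L) :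
    (∑ i ∈ Finset.univ.erase i₀, ((u i₀ : ℝ) * v j₀ - u i * v j₀) *
        (if a.1 = i then (v a.2 : ℝ) / v j₀ else 0)) +
      (∑ j ∈ Finset.univ.erase j₀, ((u i₀ : ℝ) * v j₀ - u i₀ * v j) *
        (if a.2 = j then (u a.1 : ℝ) / u i₀ else 0)) ≤
    (mean u v (i₀, j₀) : ℝ) - mean u v a := by
  have hv0 : 0 < (v j₀ : ℝ) := pos_of_mul_pos_right h0 (u i₀).2.1
  have hu0 : 0 < (u i₀ : ℝ) := pos_of_mul_pos_left h0 hv0.le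
  have hv : (v a.2 : ℝ) ≤ v j₀ := le_of_mul_le_mul_left (hb (i₀, a.2)) hu0
  have hu : (u a.1 : ℝ) ≤ u i₀ := le_of_mul_le_mul_right (hb (a.1, j₀)) hv0
  -- The terms at `i₀` and `j₀` have gap zero; with them restored, each sum collapses to the row or
  -- column of `a`.
  rw [Finset.sum_erase _ (by simp), Finset.sum_erase _ (by simp)]
  simp only [mul_ite, mul_zero, Finset.sum_ite_eq, Finset.mem_univ, if_true, mean,
    Set.Icc.coe_mul]
  have h1 : ((u i₀ : ℝ) * v j₀ - u a.1 * v j₀) * (v a.2 / v j₀) = (u i₀ - u a.1) * v a.2 := by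
    field_simp
  have h2 : ((u i₀ : ℝ) * v j₀ - u i₀ * v a.2) * (u a.1 / u i₀) = (v j₀ - v a.2) * u a.1 := by
    field_simp
  rw [h1, h2]
  nlinarith [mul_nonneg (sub_nonneg.2 hu) (sub_nonneg.2 hv)]

lemma UniformlyEfficient.eventually_le_regret {A : Algorithm K L} (hA : UniformlyEfficient A)
    {u : Fin K → I} {v : Fin L → I} {i₀ : Fin K} {j₀ : Fin L}
    (hb : IsUniqueBestArm u v (i₀, j₀)) (h0 : 0 < (u i₀ : ℝ) * v j₀)
    (h1 : (u i₀ : ℝ) * v j₀ < 1) {s : ℝ} (hs0 : 0 ≤ s) (hs1 : s < 1) :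
    ∀ᶠ n : ℕ in Filter.atTop,
      s * ((∑ i ∈ Finset.univ.erase i₀,
          ((u i₀ : ℝ) * v j₀ - u i * v j₀) / klReal (u i * v j₀) (u i₀ * v j₀)) +
        ∑ j ∈ Finset.univ.erase j₀,
          ((u i₀ : ℝ) * v j₀ - u i₀ * v j) / klReal (u i₀ * v j) (u i₀ * v j₀)) * Real.log n ≤
      regret A u v (i₀, j₀) n := by
  have hm : (u i₀ : ℝ) * v j₀ ∈ Set.Ioo (0 : ℝ) 1 := ⟨h0, h1⟩
  -- For `k = 0` this relies on `s / 0 = 0`.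
  have hθ : ∀ k : ℝ, s / k * k < 1 := fun k => by
    rcases eq_or_ne k 0 with rfl | hk
    · simp
    · rwa [div_mul_cancel₀ _ hk]
  have hrow : ∀ᶠ n : ℕ in Filter.atTop, ∀ i, i ≠ i₀ →
      s / klReal (u i * v j₀) (u i₀ * v j₀) * Real.log n ≤
        ex (histLaw (A n) (mean u v) n) fun h => ∑ t, (fun a : Arm K L =>
          if a.1 = i then (v a.2 : ℝ) / v j₀ else 0) (h t).1 := by
    refine Filter.eventually_all.2 fun i => ?_
    by_cases hi : i = i₀
    · exact Filter.Eventually.of_forall fun n h => absurd hi h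
    refine (hA.eventually_le_of_isAlternative hb (G := {a | a.1 = i}) (fun h => hi h.symm)
      (fun a => ?_) (u i * v j₀).2 hm
      (fun q => exists_isAlternative_row hb.1 h0 i)
      (div_nonneg hs0 (klReal_nonneg (u i * v j₀).2 hm)) (hθ _)).mono fun n hn _ => hn
    split_ifs
    exacts [div_nonneg (v a.2).2.1 (v j₀).2.1, le_rfl]
  have hcol : ∀ᶠ n : ℕ in Filter.atTop, ∀ j, j ≠ j₀ →
      s / klReal (u i₀ * v j) (u i₀ * v j₀) * Real.log n ≤
        ex (histLaw (A n) (mean u v) n) fun h => ∑ t, (fun a : Arm K L =>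
          if a.2 = j then (u a.1 : ℝ) / u i₀ else 0) (h t).1 := by
    refine Filter.eventually_all.2 fun j => ?_
    by_cases hj : j = j₀
    · exact Filter.Eventually.of_forall fun n h => absurd hj h
    refine (hA.eventually_le_of_isAlternative hb (G := {a | a.2 = j}) (fun h => hj h.symm)
      (fun a => ?_) (u i₀ * v j).2 hm
      (fun q => exists_isAlternative_col hb.1 h0 j)
      (div_nonneg hs0 (klReal_nonneg (u i₀ * v j).2 hm)) (hθ _)).mono fun n hn _ => hn
    split_ifs
    exacts [div_nonneg (u a.1).2.1 (u i₀).2.1, le_rfl]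
  filter_upwards [hrow, hcol] with n hr hc
  calc _ = (∑ i ∈ Finset.univ.erase i₀, ((u i₀ : ℝ) * v j₀ - u i * v j₀) *
          (s / klReal (u i * v j₀) (u i₀ * v j₀) * Real.log n)) +
        ∑ j ∈ Finset.univ.erase j₀, ((u i₀ : ℝ) * v j₀ - u i₀ * v j) *
          (s / klReal (u i₀ * v j) (u i₀ * v j₀) * Real.log n) := by
        rw [mul_add, add_mul, Finset.mul_sum, Finset.mul_sum, Finset.sum_mul, Finset.sum_mul]
        congr 1 <;> exact Finset.sum_congr rfl fun _ _ => by ring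
    _ ≤ (∑ i ∈ Finset.univ.erase i₀, ((u i₀ : ℝ) * v j₀ - u i * v j₀) *
          ex (histLaw (A n) (mean u v) n) fun h => ∑ t,
            if (h t).1.1 = i then (v (h t).1.2 : ℝ) / v j₀ else 0) +
        ∑ j ∈ Finset.univ.erase j₀, ((u i₀ : ℝ) * v j₀ - u i₀ * v j) *
          ex (histLaw (A n) (mean u v) n) fun h => ∑ t,
            if (h t).1.2 = j then (u (h t).1.1 : ℝ) / u i₀ else 0 := by
        refine add_le_add (Finset.sum_le_sum fun i hi => ?_) (Finset.sum_le_sum fun j hj => ?_)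
        · exact mul_le_mul_of_nonneg_left (hr i (Finset.ne_of_mem_erase hi))
            (sub_nonneg.2 (hb.1 (i, j₀)))
        · exact mul_le_mul_of_nonneg_left (hc j (Finset.ne_of_mem_erase hj))
            (sub_nonneg.2 (hb.1 (i₀, j)))
    _ ≤ regret A u v (i₀, j₀) n := by
        rw [regret, policyRegret_eq]
        simp only [← ex_const_mul]
        rw [← ex_sum, ← ex_sum, ← ex_add]
        refine ex_mono _ fun h => ?_
        simp only [Finset.mul_sum]
        rw [Finset.sum_comm, Finset.sum_comm (s := Finset.univ.erase j₀),
          ← Finset.sum_add_distrib]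
        exact Finset.sum_le_sum fun t _ => sum_gap_mul_weight_le hb.1 h0 (h t).1

end Regret

/-! ### Passage to extended real numbers -/

lemma coe_sum {ι : Type*} (s : Finset ι) (f : ι → ℝ) :
    ((∑ i ∈ s, f i : ℝ) : EReal) = ∑ i ∈ s, (f i : EReal) :=
  map_sum (⟨⟨Real.toEReal, EReal.coe_zero⟩, EReal.coe_add⟩ : ℝ →+ EReal) f s

lemma coe_div_d (x : ℝ) (p : I) {q : I} (hq0 : 0 < (q : ℝ)) (hq1 : (q : ℝ) < 1) :
    (x : EReal) / (d p q : EReal) = ((x / klReal p q : ℝ) : EReal) := by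
  rw [d_eq_ofReal p hq0 hq1, EReal.coe_ennreal_ofReal,
    max_eq_left (klReal_nonneg p.2 ⟨hq0, hq1⟩), EReal.coe_div]

/-- A term of the lower bound vanishes if the largest mean is zero or one. -/
lemma coe_div_d_eq_zero {p q : I} (hpq : p ≤ q) (hq : (q : ℝ) = 0 ∨ (q : ℝ) = 1) :
    (((q : ℝ) - p : ℝ) : EReal) / (d p q : EReal) = 0 := by
  have hpq' : (p : ℝ) ≤ q := hpq
  rcases hpq'.eq_or_lt with h | h
  · rw [h, sub_self, EReal.coe_zero, EReal.zero_div]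
  · rcases hq with hq | hq
    · linarith [p.2.1]
    · rw [d_one_right (hq ▸ h) hq, EReal.coe_ennreal_top, EReal.div_top]

end Rank1Bandit

end

theorem theorem2 {K L : ℕ} (u : Fin K → unitInterval) (v : Fin L → unitInterval)
    (i₀ : Fin K) (j₀ : Fin L) (hbest : Rank1Bandit.IsUniqueBestArm u v (i₀, j₀))
    (A : Rank1Bandit.Algorithm K L) (hA : Rank1Bandit.UniformlyEfficient A) :
    (∑ i ∈ Finset.univ.erase i₀,
        (((u i₀ : ℝ) * (v j₀ : ℝ) - (u i : ℝ) * (v j₀ : ℝ) : ℝ) : EReal) /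
          (Rank1Bandit.d (u i * v j₀) (u i₀ * v j₀) : EReal)) +
      (∑ j ∈ Finset.univ.erase j₀,
        (((u i₀ : ℝ) * (v j₀ : ℝ) - (u i₀ : ℝ) * (v j : ℝ) : ℝ) : EReal) /
          (Rank1Bandit.d (u i₀ * v j) (u i₀ * v j₀) : EReal)) ≤
    Filter.liminf
      (fun n : ℕ => ((Rank1Bandit.regret A u v (i₀, j₀) n / Real.log (n : ℝ) : ℝ) : EReal))
      Filter.atTop := by
  -- At best mean `0` all gaps vanish; at best mean `1` a positive gap comes with an infinite
  -- divergence. The claim is then nonnegativity of the regret.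
  by_cases hm : ((u i₀ * v j₀ : unitInterval) : ℝ) = 0 ∨ ((u i₀ * v j₀ : unitInterval) : ℝ) = 1
  · refine le_of_eq_of_le ?_ (Rank1Bandit.zero_le_liminf_regret A hbest.1)
    refine (congrArg₂ (· + ·)
      (Finset.sum_eq_zero fun i _ => Rank1Bandit.coe_div_d_eq_zero (hbest.1 (i, j₀)) hm)
      (Finset.sum_eq_zero fun j _ => Rank1Bandit.coe_div_d_eq_zero (hbest.1 (i₀, j)) hm)).trans
      (add_zero 0)
  push Not at hm
  have h0 : 0 < ((u i₀ * v j₀ : unitInterval) : ℝ) := (u i₀ * v j₀).2.1.lt_of_ne hm.1.symm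
  have h1 : ((u i₀ * v j₀ : unitInterval) : ℝ) < 1 := (u i₀ * v j₀).2.2.lt_of_ne hm.2
  simp only [Rank1Bandit.coe_div_d _ _ h0 h1, Set.Icc.coe_mul, ← Rank1Bandit.coe_sum,
    ← EReal.coe_add]
  rw [Set.Icc.coe_mul] at h0 h1
  refine le_of_forall_lt_imp_le_of_dense fun c hc => ?_
  have hev := fun {s : ℝ} => hA.eventually_le_regret hbest h0 h1 (s := s)
  set B : ℝ := _ + _ with hB
  induction c with
  | bot => exact bot_le
  | top => exact absurd hc not_top_lt
  | coe c =>
    have hc' : c < B := EReal.coe_lt_coe_iff.1 hc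
    rcases le_or_gt c 0 with hc0 | hc0
    · exact (EReal.coe_nonpos.2 hc0).trans (Rank1Bandit.zero_le_liminf_regret A hbest.1)
    have hB0 : 0 < B := hc0.trans hc'
    refine Filter.le_liminf_of_le (by isBoundedDefault) ?_
    -- The slack factor is `s = c / B`, so that `s * B = c`.
    filter_upwards [hev (div_pos hc0 hB0).le ((div_lt_one hB0).2 hc'),
      Filter.eventually_gt_atTop 1] with n hn hn1
    rw [div_mul_cancel₀ _ hB0.ne'] at hn
    exact EReal.coe_le_coe_iff.2
      ((le_div_iff₀ (Real.log_pos (by exact_mod_cast hn1))).2 hn)
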